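/- Let $p_1=(0,0)$, $p_2=(1,0)$, $p_3=(1/2,\sqrt3/2)$ and $F_i(x)=\frac12(x+p_i)$ on $\mathbb R^2$. Let $V_0=\{p_1,p_2,p_3\}$, $V_{m+1}=\bigcup_{i}F_i(V_m)$, $V_*=\bigcup_m V_m$, and let $\mathbb S=\overline{V_*}$ be the Sierpinski gasket. For a word $w=w_1\cdots w_m$ in $\{1,2,3\}$ put $F_w=F_{w_1}\circ\cdots\circ F_{w_m}$ and $\mathbb S_w=F_w(\mathbb S)$. For $u:V_*\to\mathbb R$ let $$\mathcal E^{(m)}(u)=\frac12\Big(\frac53\Big)^m\sum_{|w|=m}\ \sum_{x,y\in F_w(V_0)}\big(u(x)-u(y)\big)^2,\qquad \mathcal E(u)=\lim_{m\to\infty}\mathcal E^{(m)}(u)\in[0,\infty];$$ the sequence is non-decreasing. Let $\mathcal F(\mathbb S)$ be the set of all $u:V_*\to\mathbb R$ with $\mathcal E(u)<\infty$; each such $u$ extends uniquely to a continuous function on $\mathbb S$, again denoted by $u$. Let $\mathcal F(\mathbb S\setminus V_0)=\{u\in\mathcal F(\mathbb S):u|_{V_0}=0\}$. Let $\nu$ (the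 normalized Hausdorff measure) and $\mu$ (the Kusuoka measure) be the Borel probability measures on $\mathbb S$ such that, for every word $w$ of every length $m\ge 0$, $$\nu(\mathbb S_w)=3^{-m},\qquad \mu(\mathbb S_w)=\frac12\Big(\frac53\Big)^m\operatorname{tr}\big(A_w^{t}PA_w\big),\qquad A_w=A_{w_m}\cdots A_{w_1},$$ where $Px=x-\frac13(x_1+x_2+x_3)(1,1,1)$ on $\mathbb R^3$ and $$A_1=\tfrac15\begin{pmatrix}5&0&0\\2&2&1\\2&1&2\end{pmatrix},\quad A_2=\tfrac15\begin{pmatrix}2&2&1\\0&5&0\\1&2&2\end{pmatrix},\quad A_3=\tfrac15\begin{pmatrix}2&1&2\\1&2&2\\0&0&5\end{pmatrix}.$$ Let $d_s=2\log 3/\log 5$. Then there is a universal constant $C>0$ such that for every $u\in\mathcal F(\mathbb S)$, $$\|u\|_{L^2(\mu)}\le C\Big[\mathcal E(u)^{(d_s-1)/2}\,\|u\|_{L^2(\nu)}^{2-d_s}+\|u\|_{L^2(\nu)}\Big],$$ and for every $u\in\mathcal F(\mathbb S\setminus V_0)$, $$\|u\|_{L^2(\mu)}\le C\,\mathcal E(u)^{(d_s-1)/2}\,\|u\|_{L^2(\nu)}^{2-d_s}.$$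 -/

import Mathlib

open MeasureTheory Filter Topology
open scoped ENNReal NNReal

namespace SierpinskiGasket

noncomputable section

/-! ### The gasket -/

/-- The Euclidean plane. -/
abbrev Plane : Type := EuclideanSpace ℝ (Fin 2)

/-- The corners `(0,0)`, `(1,0)`, `(1/2, √3/2)`, that is, the three points of `V₀`. -/
def corner : Fin 3 → Plane := ![!₂[0, 0], !₂[1, 0], !₂[1 / 2, √3 / 2]]

/-- The contractions `F i x = (x + corner i) / 2`. -/
def F (i : Fin 3) (x : Plane) : Plane := (2 : ℝ)⁻¹ • (x + corner i)

/-- The sets `V m` of vertices of level `m`. -/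
def V : ℕ → Set Plane
  | 0 => Set.range corner
  | m + 1 => ⋃ i, F i '' V m

/-- `V_*`, the union of all `V m`. -/
def Vstar : Set Plane := ⋃ m, V m

/-- The compact Sierpinski gasket, the closure of `V_*`. -/
def gasket : Set Plane := closure Vstar

/-- `F_w = F_{w₁} ∘ ⋯ ∘ F_{wₘ}` for a finite word `w = w₁ … wₘ`. -/
def wordMap : List (Fin 3) → Plane → Plane
  | [] => id
  | i :: w => F i ∘ wordMap w

/-- The cell `F_w(S)`, as a subset of the gasket `S`. -/
def cell (w : List (Fin 3)) : Set gasket := {x | (x : Plane) ∈ wordMap w '' gasket}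

theorem wordMap_corner_mem (w : List (Fin 3)) (i : Fin 3) : wordMap w (corner i) ∈ V w.length := by
  induction w with
  | nil => exact ⟨i, rfl⟩
  | cons j w ih => exact Set.mem_iUnion.2 ⟨j, _, ih, rfl⟩

/-- The vertex `F_w(corner i)`, as a point of `V_*`. -/
def vertex (w : List (Fin 3)) (i : Fin 3) : Vstar :=
  ⟨wordMap w (corner i), Set.mem_iUnion.2 ⟨_, wordMap_corner_mem w i⟩⟩

/-- The inclusion of `V_*` into the gasket. -/
def toGasket (x : Vstar) : gasket := ⟨x, subset_closure x.2⟩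

/-! ### The energy -/

/-- The graph energy of level `m`: `(5/3) ^ m` times the sum of `(u x - u y)²` over all edges
`{x, y}` of level `m`, the edges being the pairs of corners of a common cell of level `m`.
The factor `1/2` is there because the double sum counts every edge twice; an edge lies in only
one cell of its level. -/
def graphEnergy (m : ℕ) (u : Vstar → ℝ) : ℝ :=
  2⁻¹ * (5 / 3) ^ m * ∑ w : Fin m → Fin 3, ∑ i, ∑ j,
    (u (vertex (List.ofFn w) i) - u (vertex (List.ofFn w) j)) ^ 2

/-- The energy `𝓔(u) ∈ [0,∞]`: the supremum of the graph energies, which is their limit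
(`tendsto_graphEnergy`). The form domain `𝓕(S)` is the set of all `u` with `energy u < ∞`. -/
def energy (u : Vstar → ℝ) : ℝ≥0∞ := ⨆ m, ENNReal.ofReal (graphEnergy m u)

theorem wordMap_append (w w' : List (Fin 3)) (x : Plane) :
    wordMap (w ++ w') x = wordMap w (wordMap w' x) := by
  induction w with
  | nil => rfl
  | cons i w ih => simp only [List.cons_append, wordMap, Function.comp_apply, ih]

theorem vertex_append_comm (w : List (Fin 3)) (i j : Fin 3) :
    vertex (w ++ [i]) j = vertex (w ++ [j]) i := by
  apply Subtype.ext
  simp [vertex, wordMap_append, wordMap, F, add_comm]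

theorem vertex_append_self (w : List (Fin 3)) (i : Fin 3) : vertex (w ++ [i]) i = vertex w i := by
  apply Subtype.ext
  simp only [vertex, wordMap_append, wordMap, F, Function.comp_apply, id]
  congr 1
  rw [← two_smul ℝ, smul_smul]
  norm_num

theorem graphEnergy_le_succ (m : ℕ) (u : Vstar → ℝ) : graphEnergy m u ≤ graphEnergy (m + 1) u := by
  have hre : ∀ g : (Fin (m + 1) → Fin 3) → ℝ,
      ∑ w, g w = ∑ w : Fin m → Fin 3, ∑ k, g (Fin.snoc w k) := by
    intro g
    rw [← (Fin.snocEquiv (fun _ : Fin (m + 1) => Fin 3)).sum_comp, Fintype.sum_prod_type,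
      Finset.sum_comm]
    rfl
  unfold graphEnergy
  rw [hre, pow_succ, ← mul_assoc, mul_assoc _ (5 / 3 : ℝ)]
  refine mul_le_mul_of_nonneg_left ?_ (by positivity)
  rw [Finset.mul_sum]
  refine Finset.sum_le_sum fun w _ => ?_
  have h : ∀ k, List.ofFn (Fin.snoc w k : Fin (m + 1) → Fin 3) = List.ofFn w ++ [k] := by
    intro k
    rw [List.ofFn_succ']
    simp
  simp only [h, Fin.sum_univ_three, vertex_append_self]
  rw [vertex_append_comm _ 1 0, vertex_append_comm _ 2 0, vertex_append_comm _ 2 1]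
  generalize u (vertex (List.ofFn w) 0) = a
  generalize u (vertex (List.ofFn w) 1) = b
  generalize u (vertex (List.ofFn w) 2) = c
  generalize u (vertex (List.ofFn w ++ [0]) 1) = x
  generalize u (vertex (List.ofFn w ++ [0]) 2) = y
  generalize u (vertex (List.ofFn w ++ [1]) 2) = z
  nlinarith [sq_nonneg (5 * x - 2 * a - 2 * b - c), sq_nonneg (5 * y - 2 * a - b - 2 * c),
    sq_nonneg (5 * z - a - 2 * b - 2 * c),
    sq_nonneg ((5 * x - 2 * a - 2 * b - c) - (5 * y - 2 * a - b - 2 * c)),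
    sq_nonneg ((5 * x - 2 * a - 2 * b - c) - (5 * z - a - 2 * b - 2 * c)),
    sq_nonneg ((5 * y - 2 * a - b - 2 * c) - (5 * z - a - 2 * b - 2 * c))]

theorem tendsto_graphEnergy (u : Vstar → ℝ) :
    Tendsto (fun m => ENNReal.ofReal (graphEnergy m u)) atTop (𝓝 (energy u)) :=
  tendsto_atTop_iSup
    (monotone_nat_of_le_succ fun m => ENNReal.ofReal_le_ofReal (graphEnergy_le_succ m u))

/-! ### Measures on the gasket with prescribed cell masses -/

/-- The first `n` letters of an infinite word. -/
def pref (n : ℕ) (ω : ℕ → Fin 3) : List (Fin 3) := List.ofFn fun k : Fin n => ω k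

/-- The infinite words that begin with `w`. -/
def cyl (w : List (Fin 3)) : Set (ℕ → Fin 3) := {ω | pref w.length ω = w}

/-- The infinite word `w ω`. -/
def cat : List (Fin 3) → (ℕ → Fin 3) → ℕ → Fin 3
  | [], ω => ω
  | i :: w, ω => fun n => Nat.casesOn n i (cat w ω)

/-- The point of the plane with a given address. -/
def code (ω : ℕ → Fin 3) : Plane := ∑' k, ((2 : ℝ)⁻¹ ^ (k + 1)) • corner (ω k)

theorem pref_succ (n : ℕ) (ω : ℕ → Fin 3) :
    pref (n + 1) ω = ω 0 :: pref n (fun k => ω (k + 1)) := by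
  simp [pref, List.ofFn_succ]

theorem pref_succ' (n : ℕ) (ω : ℕ → Fin 3) : pref (n + 1) ω = pref n ω ++ [ω n] := by
  unfold pref
  rw [List.ofFn_succ']
  simp

theorem length_pref (n : ℕ) (ω : ℕ → Fin 3) : (pref n ω).length = n := by simp [pref]

theorem mem_cyl_cons (i : Fin 3) (w : List (Fin 3)) (ω : ℕ → Fin 3) :
    ω ∈ cyl (i :: w) ↔ ω 0 = i ∧ (fun k => ω (k + 1)) ∈ cyl w := by
  simp [cyl, pref_succ]

theorem cat_mem_cyl (w : List (Fin 3)) (ω : ℕ → Fin 3) : cat w ω ∈ cyl w := by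
  induction w with
  | nil => simp [cyl, pref]
  | cons i w ih => exact (mem_cyl_cons _ _ _).2 ⟨rfl, ih⟩

theorem mem_cyl_append (w w' : List (Fin 3)) (ω : ℕ → Fin 3) :
    ω ∈ cyl (w ++ w') ↔ ω ∈ cyl w ∧ (fun k => ω (k + w.length)) ∈ cyl w' := by
  induction w generalizing ω with
  | nil => simp [cyl, pref]
  | cons i w ih =>
    rw [List.cons_append, mem_cyl_cons, mem_cyl_cons, ih, and_assoc]
    simp only [List.length_cons, add_assoc]

theorem isClopen_cyl (w : List (Fin 3)) : IsClopen (cyl w) := by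
  have hc : Continuous (fun ω : ℕ → Fin 3 => fun k : Fin w.length => ω k) := by fun_prop
  exact (isClopen_discrete {f : Fin w.length → Fin 3 | List.ofFn f = w}).preimage hc

theorem summable_code (ω : ℕ → Fin 3) :
    Summable fun k => ((2 : ℝ)⁻¹ ^ (k + 1)) • corner (ω k) := by
  obtain ⟨M, hM⟩ : ∃ M, ∀ i, ‖corner i‖ ≤ M :=
    ⟨∑ i, ‖corner i‖, fun i => Finset.single_le_sum (f := fun i => ‖corner i‖)
      (fun _ _ => norm_nonneg _) (Finset.mem_univ i)⟩
  refine Summable.of_norm_bounded (g := fun k => ((2 : ℝ)⁻¹ ^ (k + 1)) * M) ?_ ?_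
  · exact ((summable_nat_add_iff 1).2
      (summable_geometric_of_lt_one (by norm_num) (by norm_num))).mul_right M
  · intro k
    rw [norm_smul]
    gcongr
    · simp
    · exact hM _

theorem continuous_code : Continuous code := by
  obtain ⟨M, hM⟩ : ∃ M, ∀ i, ‖corner i‖ ≤ M :=
    ⟨∑ i, ‖corner i‖, fun i => Finset.single_le_sum (f := fun i => ‖corner i‖)
      (fun _ _ => norm_nonneg _) (Finset.mem_univ i)⟩
  refine continuous_tsum (u := fun k => ((2 : ℝ)⁻¹ ^ (k + 1)) * M) ?_ ?_ ?_
  · intro k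
    have h1 : Continuous corner := continuous_of_discreteTopology
    have h2 : Continuous fun ω : ℕ → Fin 3 => corner (ω k) := h1.comp (continuous_apply k)
    exact h2.const_smul ((2 : ℝ)⁻¹ ^ (k + 1))
  · exact ((summable_nat_add_iff 1).2
      (summable_geometric_of_lt_one (by norm_num) (by norm_num))).mul_right M
  · intro k ω
    rw [norm_smul]
    gcongr
    · simp
    · exact hM _

theorem code_eq (ω : ℕ → Fin 3) : code ω = F (ω 0) (code fun k => ω (k + 1)) := by
  unfold code F
  rw [(summable_code ω).tsum_eq_zero_add, smul_add, ← Summable.tsum_const_smul _ (summable_code _),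
    add_comm]
  congr 1
  · refine tsum_congr fun k => ?_
    rw [smul_smul, pow_succ' _ (k + 1)]
  · simp

theorem code_cat (w : List (Fin 3)) (ω : ℕ → Fin 3) : code (cat w ω) = wordMap w (code ω) := by
  induction w with
  | nil => rfl
  | cons i w ih =>
    rw [code_eq]
    simp only [wordMap, Function.comp_apply, ← ih]
    rfl

theorem code_const (i : Fin 3) : code (fun _ => i) = corner i := by
  unfold code
  have hs : Summable fun k : ℕ => (2 : ℝ)⁻¹ ^ (k + 1) :=
    (summable_nat_add_iff 1).2 (summable_geometric_of_lt_one (by norm_num) (by norm_num))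
  rw [hs.tsum_smul_const]
  have : ∑' k : ℕ, (2 : ℝ)⁻¹ ^ (k + 1) = 1 := by
    simp_rw [pow_succ]
    rw [tsum_mul_right, tsum_geometric_of_lt_one (by norm_num) (by norm_num)]
    norm_num
  rw [this, one_smul]

theorem V_subset_range (m : ℕ) : V m ⊆ Set.range code := by
  induction m with
  | zero =>
    rintro _ ⟨i, rfl⟩
    exact ⟨_, code_const i⟩
  | succ m ih =>
    intro x hx
    obtain ⟨i, y, hy, rfl⟩ := Set.mem_iUnion.1 hx
    obtain ⟨ω, rfl⟩ := ih hy
    exact ⟨cat [i] ω, code_cat [i] ω⟩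

theorem tendsto_cat_pref (ω ω' : ℕ → Fin 3) :
    Tendsto (fun n => cat (pref n ω) ω') atTop (𝓝 ω) := by
  rw [tendsto_pi_nhds]
  intro k
  refine tendsto_const_nhds.congr' ?_
  filter_upwards [eventually_gt_atTop k] with n hn
  have h := cat_mem_cyl (pref n ω) ω'
  simp only [cyl, Set.mem_ofPred_eq] at h
  rw [length_pref] at h
  exact (congrFun (List.ofFn_injective h) ⟨k, hn⟩).symm

/-- The gasket is the set of all points that have an address. -/
theorem gasket_eq_range : gasket = Set.range code := by
  apply Set.Subset.antisymm
  · exact closure_minimal (Set.iUnion_subset V_subset_range)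
      (isCompact_range continuous_code).isClosed
  · rintro _ ⟨ω, rfl⟩
    refine mem_closure_of_tendsto
      ((continuous_code.tendsto ω).comp (tendsto_cat_pref ω fun _ => 0)) (Eventually.of_forall ?_)
    intro n
    simp only [Function.comp_apply, code_cat, code_const]
    exact Set.mem_iUnion.2 ⟨_, wordMap_corner_mem _ _⟩

/-- The barycentric coordinates with respect to the three corners. -/
def bary (x : Plane) : Fin 3 → ℝ :=
  ![1 - x 0 - x 1 / √3, x 0 - x 1 / √3, 2 * x 1 / √3]

theorem bary_F (i j : Fin 3) (x : Plane) :
    bary (F i x) j = (bary x j + if i = j then 1 else 0) / 2 := by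
  have h3 : √3 ≠ 0 := by positivity
  fin_cases i <;> fin_cases j <;> simp [bary, F, corner] <;> field_simp <;> ring_nf

theorem bary_corner (i j : Fin 3) : bary (corner i) j = if i = j then 1 else 0 := by
  have h3 : √3 ≠ 0 := by positivity
  fin_cases i <;> fin_cases j <;> simp [bary, corner] <;> field_simp <;> norm_num

theorem bary_mem_Icc_of_mem_V (m : ℕ) (j : Fin 3) : ∀ x ∈ V m, bary x j ∈ Set.Icc (0 : ℝ) 1 := by
  induction m with
  | zero =>
    rintro _ ⟨i, rfl⟩
    rw [bary_corner]
    split_ifs <;> simp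
  | succ m ih =>
    intro x hx
    obtain ⟨i, y, hy, rfl⟩ := Set.mem_iUnion.1 hx
    have := ih y hy
    rw [bary_F]
    constructor <;> split_ifs <;> linarith [this.1, this.2]

theorem bary_mem_Icc (j : Fin 3) (ω : ℕ → Fin 3) : bary (code ω) j ∈ Set.Icc (0 : ℝ) 1 := by
  have hc : Continuous fun x : Plane => bary x j := by
    fin_cases j <;> simp [bary] <;> fun_prop
  have : gasket ⊆ (fun x => bary x j) ⁻¹' Set.Icc (0 : ℝ) 1 :=
    closure_minimal (Set.iUnion_subset fun m x hx => bary_mem_Icc_of_mem_V m j x hx)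
      (isClosed_Icc.preimage hc)
  exact this (gasket_eq_range ▸ Set.mem_range_self ω)

theorem eq_const_of_bary (j : Fin 3) (n : ℕ) :
    ∀ ω : ℕ → Fin 3, bary (code ω) j = 1 → ω n = j := by
  have key : ∀ ω : ℕ → Fin 3, bary (code ω) j = 1 →
      ω 0 = j ∧ bary (code fun k => ω (k + 1)) j = 1 := by
    intro ω h
    rw [code_eq, bary_F] at h
    have := (bary_mem_Icc j fun k => ω (k + 1)).2
    by_cases h0 : ω 0 = j
    · simp only [h0, if_true] at h
      exact ⟨h0, by linarith⟩
    · simp only [h0, if_false] at h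
      linarith
  induction n with
  | zero => exact fun ω h => (key ω h).1
  | succ n ih => exact fun ω h => ih _ (key ω h).2

theorem F_injective (i : Fin 3) : Function.Injective (F i) := by
  intro x y h
  have := smul_right_injective Plane (r := (2 : ℝ)⁻¹) (by norm_num) h
  exact add_right_cancel this

/-- An infinite word that is not the only address of its point is eventually constant. -/
theorem eventually_const_of_code_eq (n : ℕ) : ∀ ω ω' : ℕ → Fin 3, code ω = code ω' → ω n ≠ ω' n →
    (∀ k < n, ω k = ω' k) → ∃ j, ∀ k, ω (n + 1 + k) = j := by
  induction n with
  | zero =>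
    intro ω ω' h hne _
    refine ⟨ω' 0, fun k => ?_⟩
    have h1 := congrArg (fun x => bary x (ω' 0)) h
    simp only [code_eq ω, code_eq ω', bary_F, if_neg hne, if_true] at h1
    have h2 := (bary_mem_Icc (ω' 0) fun k => ω' (k + 1)).1
    have h3 := (bary_mem_Icc (ω' 0) fun k => ω (k + 1)).2
    have := eq_const_of_bary (ω' 0) k (fun k => ω (k + 1)) (by linarith)
    rw [← this]
    congr 1
    omega
  | succ n ih =>
    intro ω ω' h hne hlt
    rw [code_eq ω, code_eq ω', hlt 0 (by omega)] at h
    obtain ⟨j, hj⟩ := ih (fun k => ω (k + 1)) (fun k => ω' (k + 1)) (F_injective _ h) hne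
      fun k hk => hlt (k + 1) (by omega)
    refine ⟨j, fun k => ?_⟩
    rw [← hj k]
    congr 1
    omega

theorem countable_multiple : {ω : ℕ → Fin 3 | ∃ ω', ω' ≠ ω ∧ code ω = code ω'}.Countable := by
  have hsub : {ω : ℕ → Fin 3 | ∃ ω', ω' ≠ ω ∧ code ω = code ω'} ⊆
      Set.range fun p : List (Fin 3) × Fin 3 => fun n : ℕ => p.1.getD n p.2 := by
    rintro ω ⟨ω', hne, h⟩
    have hex : ∃ n, ω n ≠ ω' n := by
      by_contra hcon
      push Not at hcon
      exact hne (funext fun n => (hcon n).symm)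
    classical
    obtain ⟨j, hj⟩ := eventually_const_of_code_eq (Nat.find hex) ω ω' h (Nat.find_spec hex)
      fun k hk => not_not.1 (Nat.find_min hex hk)
    refine ⟨(pref (Nat.find hex + 1) ω, j), funext fun n => ?_⟩
    by_cases hn : n < Nat.find hex + 1
    · refine (List.getD_eq_getElem _ _ (by rwa [length_pref])).trans ?_
      simp only [pref, List.getElem_ofFn]
    · obtain ⟨k, rfl⟩ := Nat.exists_eq_add_of_le (not_lt.1 hn)
      rw [hj k]
      exact List.getD_eq_default _ _ (by rw [length_pref]; omega)
  exact (Set.countable_range _).mono hsub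

/-- Approximating measures on the infinite words, with the mass `m v` on the words beginning
with `v`, split correctly among the cylinders of the next `k` levels. -/
def approx (m : List (Fin 3) → ℝ≥0∞) : ℕ → List (Fin 3) → Measure (ℕ → Fin 3)
  | 0, v => m v • Measure.dirac (cat v fun _ => 0)
  | k + 1, v => ∑ i, approx m k (v ++ [i])

theorem approx_compl (m : List (Fin 3) → ℝ≥0∞) (k : ℕ) (v : List (Fin 3)) :
    approx m k v (cyl v)ᶜ = 0 := by
  induction k generalizing v with
  | zero => simp [approx, (isClopen_cyl v).isOpen.measurableSet.compl, cat_mem_cyl]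
  | succ k ih =>
    simp only [approx, Measure.coe_finsetSum, Finset.sum_apply, Finset.sum_eq_zero_iff,
      Finset.mem_univ, true_imp_iff]
    intro i
    refine measure_mono_null (Set.compl_subset_compl.2 ?_) (ih (v ++ [i]))
    exact fun ω hω => ((mem_cyl_append _ _ _).1 hω).1

theorem approx_univ (m : List (Fin 3) → ℝ≥0∞) (hadd : ∀ w, m w = ∑ i, m (w ++ [i])) (k : ℕ)
    (v : List (Fin 3)) : approx m k v Set.univ = m v := by
  induction k generalizing v with
  | zero => simp [approx]
  | succ k ih => simp [approx, ih, ← hadd]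

theorem approx_cyl (m : List (Fin 3) → ℝ≥0∞) (hadd : ∀ w, m w = ∑ i, m (w ++ [i])) (k : ℕ) :
    ∀ v w : List (Fin 3), w.length ≤ k → approx m k v (cyl (v ++ w)) = m (v ++ w) := by
  have hnil : ∀ k v, approx m k v (cyl v) = m v := by
    intro k v
    rw [← approx_univ m hadd k v]
    exact measure_congr (eventuallyEq_univ.2 (mem_ae_iff.2 (approx_compl m k v)))
  induction k with
  | zero =>
    intro v w hw
    rw [List.length_eq_zero_iff.1 (Nat.le_zero.1 hw), List.append_nil, hnil]
  | succ k ih =>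
    intro v w hw
    cases w with
    | nil => rw [List.append_nil, hnil]
    | cons i w =>
      simp only [approx, Measure.coe_finsetSum, Finset.sum_apply]
      rw [List.append_cons, Finset.sum_eq_single i, ih (v ++ [i]) w (by simpa using hw)]
      · intro j _ hj
        refine measure_mono_null ?_ (approx_compl m k (v ++ [j]))
        intro ω hω hω'
        rw [← List.append_cons] at hω
        have h1 := ((mem_cyl_append _ _ _).1 hω).2
        have h2 := ((mem_cyl_append _ _ _).1 hω').2
        rw [mem_cyl_cons] at h1 h2
        exact hj (h2.1.symm.trans h1.1)
      · simp

/-- Consistent cylinder masses define a probability measure on the infinite words. -/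
theorem exists_word_measure (m : List (Fin 3) → ℝ≥0∞) (hnil : m [] = 1)
    (hadd : ∀ w, m w = ∑ i, m (w ++ [i])) :
    ∃ μ : Measure (ℕ → Fin 3), IsProbabilityMeasure μ ∧ ∀ w, μ (cyl w) = m w := by
  let P : ℕ → ProbabilityMeasure (ℕ → Fin 3) := fun k =>
    ⟨approx m k [], ⟨by rw [approx_univ m hadd, hnil]⟩⟩
  obtain ⟨μ, hμ⟩ := exists_clusterPt_of_compactSpace (map P atTop)
  obtain ⟨U, hU, hUμ⟩ := mapClusterPt_iff_ultrafilter.1 hμ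
  refine ⟨μ, inferInstance, fun w => ?_⟩
  have h1 : Tendsto (fun k => (P k : Measure (ℕ → Fin 3)) (cyl w)) U (𝓝 ((μ : Measure (ℕ → Fin 3)) (cyl w))) := by
    refine ProbabilityMeasure.tendsto_measure_of_null_frontier_of_tendsto' hUμ ?_
    simp [(isClopen_cyl w).frontier_eq]
  have h2 : Tendsto (fun k => (P k : Measure (ℕ → Fin 3)) (cyl w)) U (𝓝 (m w)) := by
    refine tendsto_const_nhds.congr' (hU ?_)
    filter_upwards [eventually_ge_atTop w.length] with k hk
    exact (approx_cyl m hadd k [] w hk).symm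
  exact tendsto_nhds_unique h1 h2

/-- Consistent cell masses that decay geometrically define a probability measure on the gasket. -/
theorem exists_cell_measure (m : List (Fin 3) → ℝ≥0∞) (hnil : m [] = 1)
    (hadd : ∀ w, m w = ∑ i, m (w ++ [i])) (r : ℝ≥0∞) (hr : r < 1)
    (hdec : ∀ w i, m (w ++ [i]) ≤ r * m w) :
    ∃ μ : Measure gasket, IsProbabilityMeasure μ ∧ ∀ w, μ (cell w) = m w := by
  obtain ⟨μ, hprob, hμ⟩ := exists_word_measure m hnil hadd
  let c : (ℕ → Fin 3) → gasket := fun ω => ⟨code ω, gasket_eq_range ▸ Set.mem_range_self ω⟩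
  have hc : Continuous c := continuous_code.subtype_mk _
  have hpt : ∀ ω, μ {ω} = 0 := by
    intro ω
    have hle : ∀ n, μ {ω} ≤ r ^ n := by
      intro n
      have h1 : μ {ω} ≤ m (pref n ω) := by
        rw [← hμ]
        exact measure_mono (Set.singleton_subset_iff.2 (by simp [cyl, length_pref]))
      refine h1.trans ?_
      clear h1
      induction n with
      | zero => simp [pref, hnil]
      | succ n ih =>
        rw [pref_succ', pow_succ']
        exact (hdec _ _).trans (by gcongr)
    exact le_antisymm (ge_of_tendsto' (ENNReal.tendsto_pow_atTop_nhds_zero_of_lt_one hr) hle)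
      bot_le
  have hcell : ∀ w, c ⁻¹' cell w =ᵐ[μ] cyl w := by
    intro w
    have hnull : μ {ω : ℕ → Fin 3 | ∃ ω', ω' ≠ ω ∧ code ω = code ω'} = 0 := by
      have : NullSingletonClass μ := ⟨hpt⟩
      exact countable_multiple.measure_zero μ
    have hdrop : ∀ ω ∈ cyl w, code ω ∈ wordMap w '' gasket := by
      intro ω hω
      refine ⟨code fun k => ω (k + w.length), gasket_eq_range ▸ Set.mem_range_self _, ?_⟩
      clear hnull
      induction w generalizing ω with
      | nil => rfl
      | cons i w ih =>
        rw [mem_cyl_cons] at hω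
        rw [code_eq ω, ← ih _ hω.2, hω.1]
        simp only [wordMap, Function.comp_apply, List.length_cons, add_assoc]
    refine Filter.eventuallyEq_set.2 ?_
    filter_upwards [compl_mem_ae_iff.2 hnull] with ω hω
    constructor
    · rintro ⟨x, hx, hxω⟩
      rw [gasket_eq_range] at hx
      obtain ⟨ω', rfl⟩ := hx
      by_contra hcon
      refine hω ⟨cat w ω', fun heq => hcon (heq ▸ cat_mem_cyl w ω'), ?_⟩
      rw [code_cat, hxω]
    · exact fun h => hdrop ω h
  have hmeas : ∀ w, MeasurableSet (cell w) := by
    intro w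
    have hw : Continuous (wordMap w) := by
      induction w with
      | nil => exact continuous_id
      | cons i w ih =>
        refine Continuous.comp ?_ ih
        unfold F
        fun_prop
    have hcomp : IsCompact gasket := gasket_eq_range ▸ isCompact_range continuous_code
    exact ((hcomp.image hw).isClosed.preimage continuous_subtype_val).measurableSet
  refine ⟨μ.map c, Measure.isProbabilityMeasure_map hc.aemeasurable, fun w => ?_⟩
  rw [Measure.map_apply hc.measurable (hmeas w), measure_congr (hcell w), hμ]

/-! ### The Hausdorff measure and the Kusuoka measure -/

theorem exists_hausdorffMeasure : ∃ ν : Measure gasket, IsProbabilityMeasure ν ∧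
    ∀ w : List (Fin 3), ν (cell w) = (3⁻¹ : ℝ≥0∞) ^ w.length := by
  refine exists_cell_measure (fun w => (3⁻¹ : ℝ≥0∞) ^ w.length) (by simp) ?_ 3⁻¹ ?_ ?_
  · intro w
    simp only [List.length_append, List.length_singleton, pow_succ, Finset.sum_const,
      Finset.card_univ, Fintype.card_fin, nsmul_eq_mul]
    rw [mul_left_comm, Nat.cast_ofNat, ENNReal.mul_inv_cancel (by norm_num) (by norm_num), mul_one]
  · exact ENNReal.inv_lt_one.2 (by norm_num)
  · intro w i
    simp [pow_succ']

/-- The (normalized) Hausdorff measure `ν`: the Borel probability measure on the gasket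
with mass `3 ^ (-m)` on every cell of level `m`. -/
def hausdorffMeasure : Measure gasket := Classical.choose exists_hausdorffMeasure

instance : IsProbabilityMeasure hausdorffMeasure := (Classical.choose_spec exists_hausdorffMeasure).1

theorem hausdorffMeasure_cell (w : List (Fin 3)) :
    hausdorffMeasure (cell w) = (3⁻¹ : ℝ≥0∞) ^ w.length :=
  (Classical.choose_spec exists_hausdorffMeasure).2 w

/-- The matrices `A₁`, `A₂`, `A₃` of the harmonic extension. -/
def A : Fin 3 → Matrix (Fin 3) (Fin 3) ℝ :=
  ![(1 / 5 : ℝ) • !![5, 0, 0; 2, 2, 1; 2, 1, 2],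
    (1 / 5 : ℝ) • !![2, 2, 1; 0, 5, 0; 1, 2, 2],
    (1 / 5 : ℝ) • !![2, 1, 2; 1, 2, 2; 0, 0, 5]]

/-- `A_w = A_{wₘ} ⋯ A_{w₂} A_{w₁}` for a word `w = w₁ … wₘ`. -/
def wordMatrix : List (Fin 3) → Matrix (Fin 3) (Fin 3) ℝ
  | [] => 1
  | i :: w => wordMatrix w * A i

/-- The matrix of the projection `P x = x - (x₁ + x₂ + x₃) / 3`. -/
def P : Matrix (Fin 3) (Fin 3) ℝ := 1 - Matrix.of fun _ _ => 1 / 3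

/-- The Kusuoka mass `(1/2) (5/3) ^ m tr(A_wᵀ P A_w)` of the cell of a word `w` of length `m`. -/
def kusuokaMass (w : List (Fin 3)) : ℝ :=
  2⁻¹ * (5 / 3) ^ w.length * ((wordMatrix w).transpose * P * wordMatrix w).trace

theorem wordMatrix_append (w : List (Fin 3)) (i : Fin 3) :
    wordMatrix (w ++ [i]) = A i * wordMatrix w := by
  induction w with
  | nil => simp [wordMatrix]
  | cons j w ih => simp only [List.cons_append, wordMatrix, ih, Matrix.mul_assoc]

theorem trace_eq (B : Matrix (Fin 3) (Fin 3) ℝ) : (B.transpose * P * B).trace =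
    ∑ k, ((B 0 k - B 1 k) ^ 2 + (B 1 k - B 2 k) ^ 2 + (B 0 k - B 2 k) ^ 2) / 3 := by
  simp [Matrix.trace, Matrix.mul_apply, P, Fin.sum_univ_three, Matrix.one_apply]
  ring

theorem kusuokaMass_nonneg (w : List (Fin 3)) : 0 ≤ kusuokaMass w := by
  rw [kusuokaMass, trace_eq]
  positivity

theorem kusuokaMass_add (w : List (Fin 3)) : kusuokaMass w = ∑ i, kusuokaMass (w ++ [i]) := by
  simp only [kusuokaMass, trace_eq, wordMatrix_append, List.length_append, List.length_singleton,
    pow_succ, Fin.sum_univ_three, A, Matrix.mul_apply]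
  simp
  ring_nf

theorem kusuokaMass_le (w : List (Fin 3)) (i : Fin 3) :
    kusuokaMass (w ++ [i]) ≤ 3 / 5 * kusuokaMass w := by
  simp only [kusuokaMass, trace_eq, wordMatrix_append, List.length_append, List.length_singleton,
    pow_succ]
  have h : ∀ B : Matrix (Fin 3) (Fin 3) ℝ, ∀ k,
      (((A i * B) 0 k - (A i * B) 1 k) ^ 2 + ((A i * B) 1 k - (A i * B) 2 k) ^ 2 +
        ((A i * B) 0 k - (A i * B) 2 k) ^ 2) / 3 ≤
      9 / 25 * (((B 0 k - B 1 k) ^ 2 + (B 1 k - B 2 k) ^ 2 + (B 0 k - B 2 k) ^ 2) / 3) := by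
    intro B k
    fin_cases i <;> simp [A, Matrix.mul_apply, Fin.sum_univ_three] <;>
      nlinarith [sq_nonneg (B 0 k - B 1 k), sq_nonneg (B 1 k - B 2 k), sq_nonneg (B 0 k - B 2 k)]
  have h2 := Finset.sum_le_sum fun k (_ : k ∈ Finset.univ) => h (wordMatrix w) k
  rw [← Finset.mul_sum] at h2
  have h3 := mul_le_mul_of_nonneg_left h2
    (show (0 : ℝ) ≤ 2⁻¹ * ((5 / 3) ^ w.length * (5 / 3)) by positivity)
  refine h3.trans (le_of_eq ?_)
  ring

theorem exists_kusuokaMeasure : ∃ μ : Measure gasket, IsProbabilityMeasure μ ∧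
    ∀ w : List (Fin 3), μ (cell w) = ENNReal.ofReal (kusuokaMass w) := by
  refine exists_cell_measure (fun w => ENNReal.ofReal (kusuokaMass w)) ?_ ?_
    (ENNReal.ofReal (3 / 5)) ?_ ?_
  · have h : kusuokaMass [] = 1 := by
      simp [kusuokaMass, wordMatrix, P, Matrix.trace]
      norm_num
    simp [h]
  · intro w
    rw [kusuokaMass_add w, ENNReal.ofReal_sum_of_nonneg fun i _ => kusuokaMass_nonneg _]
  · rw [ENNReal.ofReal_lt_one]
    norm_num
  · intro w i
    rw [← ENNReal.ofReal_mul (by norm_num)]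
    exact ENNReal.ofReal_le_ofReal (kusuokaMass_le w i)

/-- The Kusuoka measure `μ`: the Borel probability measure on the gasket with the mass
`(1/2) (5/3) ^ m tr(A_wᵀ P A_w)` on the cell of every word `w` of length `m`. -/
def kusuokaMeasure : Measure gasket := Classical.choose exists_kusuokaMeasure

instance : IsProbabilityMeasure kusuokaMeasure := (Classical.choose_spec exists_kusuokaMeasure).1

theorem kusuokaMeasure_cell (w : List (Fin 3)) :
    kusuokaMeasure (cell w) = ENNReal.ofReal (kusuokaMass w) :=
  (Classical.choose_spec exists_kusuokaMeasure).2 w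

/-- The spectral dimension `2 log 3 / log 5`. -/
def spectralDim : ℝ := 2 * Real.log 3 / Real.log 5

end

end SierpinskiGasket

namespace SierpinskiGasket

/-! Cut the gasket into its `3 ^ m` cells of level `m`. On a cell, the squared oscillation of `u` is
at most `100` times the energy of `u ∘ F_w` (`enorm_sub_sq_le`), so `u²` at any point is at most
twice its `ν`-mean over the cell plus `200` times that energy (`setLIntegral_cell_le`). The Kusuoka
mass of the cell is at most `(3/5) ^ m`, its `ν`-mass is `3 ^ (-m)`, and self-similarity gives `∑
𝓔(u ∘ F_w) = (3/5) ^ m 𝓔(u)`. Summing over the cells yields, for every `m`, `‖u‖²_{L²(μ)} ≤ 2 (9/5)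
^ m ‖u‖²_{L²(ν)} + 200 (9/25) ^ m 𝓔(u)` (`lintegral_kusuokaMeasure_le`).

The two terms balance when `5 ^ m` is about `𝓔(u) / ‖u‖²_{L²(ν)}`. Since `5 ^ (d_s - 1) = 9/5`, this
choice turns the right side into a multiple of `𝓔(u) ^ (d_s - 1) ‖u‖_{L²(ν)} ^ (2 (2 - d_s))`, the
square of the desired bound (`interpolation_of_scales`). No such `m ≥ 0` exists when the ratio is
below `1`; then `m = 0` gives the additive term `‖u‖_{L²(ν)}`. If `u` vanishes on `V₀`, the
oscillation bound on the whole gasket is a Poincaré inequality `‖u‖²_{L²(ν)} ≤ 100 𝓔(u)`, which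
absorbs this term. -/

/-! ### The exponent and the optimisation over scales -/

theorem spectralDim_mem_Icc : spectralDim ∈ Set.Icc (1 : ℝ) 2 := by
  have h5 : 0 < Real.log 5 := Real.log_pos (by norm_num)
  have h9 : 2 * Real.log 3 = Real.log 9 := by
    rw [show (9 : ℝ) = 3 ^ 2 by norm_num, Real.log_pow]; norm_num
  have h25 : 2 * Real.log 5 = Real.log 25 := by
    rw [show (25 : ℝ) = 5 ^ 2 by norm_num, Real.log_pow]; norm_num
  unfold spectralDim
  constructor
  · rw [le_div_iff₀ h5, h9, one_mul]
    exact Real.log_le_log (by norm_num) (by norm_num)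
  · rw [div_le_iff₀ h5, h9, h25]
    exact Real.log_le_log (by norm_num) (by norm_num)

/-- This is where the spectral dimension enters: one level down, the `L²(ν)` term grows by `9/5`,
while its ratio to the energy term grows by `(9/5) / (9/25) = 5`. -/
theorem five_rpow_spectralDim_sub_one : (5 : ℝ) ^ (spectralDim - 1) = 9 / 5 := by
  have h5 : Real.log 5 ≠ 0 := (Real.log_pos (by norm_num)).ne'
  have h : (5 : ℝ) ^ spectralDim = 9 := by
    rw [Real.rpow_def_of_pos (by norm_num), spectralDim, mul_div_cancel₀ _ h5, mul_comm,
      Real.exp_mul, Real.exp_log (by norm_num)]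
    norm_num
  rw [Real.rpow_sub_one (by norm_num), h]

/-- Optimising over the scale `m` a bound that balances the `L²(ν)` norm `b` with the
energy `e`. -/
theorem interpolation_of_scales {a b e : ℝ} (ha : 0 ≤ a) (hb : 0 ≤ b) (he : 0 ≤ e)
    (h : ∀ m : ℕ, a ^ 2 ≤ 2 * (9 / 5) ^ m * b ^ 2 + 200 * (9 / 25) ^ m * e) :
    a ≤ 200 * (e ^ ((spectralDim - 1) / 2) * b ^ (2 - spectralDim) + b) ∧
      (b ^ 2 ≤ 100 * e → a ≤ 200 * (e ^ ((spectralDim - 1) / 2) * b ^ (2 - spectralDim))) := by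
  obtain ⟨hd1, hd2⟩ := spectralDim_mem_Icc
  set d := spectralDim with hd
  set t := e ^ ((d - 1) / 2) * b ^ (2 - d) with ht
  have ht0 : 0 ≤ t := by positivity
  have ht2 : t ^ 2 = e ^ (d - 1) * (b ^ (2 - d)) ^ 2 := by
    rw [ht, mul_pow, ← Real.rpow_mul_natCast he]
    norm_num
  rcases hb.eq_or_lt with rfl | hb
  -- For `b = 0` only the energy term is left, and it vanishes as `m → ∞`.
  · have ha0 : a = 0 := by
      have hlim : Tendsto (fun m : ℕ => 2 * (9 / 5 : ℝ) ^ m * 0 ^ 2 + 200 * (9 / 25) ^ m * e) atTop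
          (𝓝 0) := by
        have := ((tendsto_pow_atTop_nhds_zero_of_lt_one (r := (9 / 25 : ℝ)) (by norm_num)
          (by norm_num)).const_mul 200).mul_const e
        simpa using this
      have := ge_of_tendsto' hlim h
      nlinarith
    subst ha0
    exact ⟨by positivity, fun _ => by positivity⟩
  -- The same factorisation as `ht2`, with `b ^ 2` in place of `e`; comparing `b ^ 2` with `t ^ 2`
  -- thus amounts to comparing `b ^ 2` with `e`.
  have hb2 : b ^ 2 = (b ^ 2) ^ (d - 1) * (b ^ (2 - d)) ^ 2 := by
    rw [← Real.rpow_mul_natCast hb.le, ← Real.rpow_natCast b 2, ← Real.rpow_mul hb.le,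
      ← Real.rpow_add hb]
    congr 1
    push_cast
    ring
  -- For `e < b ^ 2` the coarsest scale `m = 0` is used.
  rcases lt_or_ge e (b ^ 2) with hlt | hge
  · have h0 : a ^ 2 ≤ 202 * b ^ 2 := by
      have := h 0
      simp only [pow_zero, mul_one] at this
      linarith
    constructor
    · have : a ≤ 200 * b := abs_le_of_sq_le_sq' (by nlinarith [sq_nonneg b]) (by positivity) |>.2
      linarith
    · intro hbe
      -- As `d - 1 ≤ 1`, also `100 ^ (d - 1) ≤ 100`. In the end `a ^ 2 ≤ 202 * 100 * t ^ 2`, which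
      -- fits below `200 ^ 2 * t ^ 2`.
      have h1 : (b ^ 2) ^ (d - 1) ≤ 100 * e ^ (d - 1) := by
        refine (Real.rpow_le_rpow (by positivity) hbe (by linarith)).trans ?_
        rw [Real.mul_rpow (by norm_num) he]
        gcongr
        exact (Real.rpow_le_rpow_of_exponent_le (by norm_num) (by linarith)).trans_eq
          (Real.rpow_one _)
      have h2 : b ^ 2 ≤ 100 * t ^ 2 := by
        rw [ht2, hb2, ← mul_assoc]
        exact mul_le_mul_of_nonneg_right h1 (sq_nonneg _)
      exact abs_le_of_sq_le_sq' (by nlinarith [sq_nonneg t]) (by positivity) |>.2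
  · have hb2pos : 0 < b ^ 2 := by positivity
    -- The balancing scale `5 ^ m ≤ e / b ^ 2 < 5 ^ (m + 1)`: the upper bound controls the energy
    -- term by the other one, at the cost of a factor `5`, and the lower bound controls `(9/5) ^ m`.
    obtain ⟨m, hm1, hm2⟩ := exists_nat_pow_near (x := e / b ^ 2) (y := (5 : ℝ))
      ((one_le_div hb2pos).2 hge) (by norm_num)
    have h1 : (9 / 25 : ℝ) ^ m * e ≤ 5 * ((9 / 5) ^ m * b ^ 2) := by
      rw [div_lt_iff₀ hb2pos, pow_succ] at hm2
      have : (9 / 25 : ℝ) ^ m * 5 ^ m = (9 / 5) ^ m := by rw [← mul_pow]; norm_num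
      rw [← this]
      have := mul_le_mul_of_nonneg_left hm2.le (show (0 : ℝ) ≤ (9 / 25) ^ m by positivity)
      linarith
    have h2 : (9 / 5 : ℝ) ^ m * b ^ 2 ≤ t ^ 2 := by
      have h3 : (9 / 5 : ℝ) ^ m ≤ (e / b ^ 2) ^ (d - 1) := by
        refine le_trans (le_of_eq ?_) (Real.rpow_le_rpow (by positivity) hm1 (by linarith))
        rw [← five_rpow_spectralDim_sub_one, ← Real.rpow_mul_natCast (by norm_num),
          ← Real.rpow_natCast_mul (by norm_num), mul_comm]
      calc (9 / 5 : ℝ) ^ m * b ^ 2 ≤ (e / b ^ 2) ^ (d - 1) * b ^ 2 := by gcongr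
        _ = t ^ 2 := by
          rw [ht2, Real.div_rpow he (by positivity)]
          nth_rewrite 2 [hb2]
          have : (b ^ 2) ^ (d - 1) ≠ 0 := by positivity
          field_simp
    have h3 : a ≤ 200 * t := by
      have := h m
      exact abs_le_of_sq_le_sq' (by nlinarith [sq_nonneg t]) (by positivity) |>.2
    exact ⟨by linarith, fun _ => h3⟩

/-! ### The maps of the cells -/

theorem F_mem_Vstar (i : Fin 3) {x : Plane} (hx : x ∈ Vstar) : F i x ∈ Vstar := by
  obtain ⟨m, hm⟩ := Set.mem_iUnion.1 hx
  exact Set.mem_iUnion.2 ⟨m + 1, Set.mem_iUnion.2 ⟨i, x, hm, rfl⟩⟩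

theorem wordMap_mem_Vstar (w : List (Fin 3)) {x : Plane} (hx : x ∈ Vstar) :
    wordMap w x ∈ Vstar := by
  induction w with
  | nil => exact hx
  | cons i w ih => exact F_mem_Vstar i ih

theorem continuous_wordMap (w : List (Fin 3)) : Continuous (wordMap w) := by
  induction w with
  | nil => exact continuous_id
  | cons i w ih =>
    refine Continuous.comp ?_ ih
    unfold F
    fun_prop

theorem wordMap_mem_gasket (w : List (Fin 3)) {x : Plane} (hx : x ∈ gasket) :
    wordMap w x ∈ gasket := by
  rw [gasket_eq_range] at hx ⊢
  obtain ⟨ω, rfl⟩ := hx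
  exact ⟨cat w ω, code_cat w ω⟩

/-- The map `F_w` on `V_*`. -/
noncomputable def vertexMap (w : List (Fin 3)) (x : Vstar) : Vstar := ⟨wordMap w x, wordMap_mem_Vstar w x.2⟩

/-- The map `F_w` on the gasket. -/
noncomputable def gasketMap (w : List (Fin 3)) : C(gasket, gasket) where
  toFun x := ⟨wordMap w x, wordMap_mem_gasket w x.2⟩
  continuous_toFun := ((continuous_wordMap w).comp continuous_subtype_val).subtype_mk _

theorem vertexMap_vertex (w w' : List (Fin 3)) (i : Fin 3) :
    vertexMap w (vertex w' i) = vertex (w ++ w') i :=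
  Subtype.ext (wordMap_append w w' _).symm

theorem vertexMap_append (w w' : List (Fin 3)) :
    vertexMap (w ++ w') = vertexMap w ∘ vertexMap w' :=
  funext fun x => Subtype.ext (wordMap_append w w' x)

theorem vertexMap_nil : vertexMap [] = id := rfl

theorem exists_eq_vertex (x : Vstar) : ∃ w i, x = vertex w i := by
  obtain ⟨x, hx⟩ := x
  obtain ⟨m, hm⟩ := Set.mem_iUnion.1 hx
  suffices ∃ w i, x = wordMap w (corner i) by
    obtain ⟨w, i, h⟩ := this
    exact ⟨w, i, Subtype.ext h⟩
  clear hx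
  induction m generalizing x with
  | zero =>
    obtain ⟨i, rfl⟩ := hm
    exact ⟨[], i, rfl⟩
  | succ m ih =>
    obtain ⟨j, y, hy, rfl⟩ := Set.mem_iUnion.1 hm
    obtain ⟨w, i, rfl⟩ := ih y hy
    exact ⟨j :: w, i, rfl⟩

theorem denseRange_toGasket : DenseRange toGasket := by
  intro x
  rw [closure_subtype]
  have : ((↑) '' Set.range toGasket : Set Plane) = Vstar := by
    rw [← Set.range_comp]
    exact Subtype.range_coe
  rw [this]
  exact x.2

/-! ### Self-similarity of the energy -/

theorem graphEnergy_nonneg (m : ℕ) (u : Vstar → ℝ) : 0 ≤ graphEnergy m u := by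
  unfold graphEnergy
  positivity

theorem sum_words_succ {M : Type*} [AddCommMonoid M] (m : ℕ) (g : List (Fin 3) → M) :
    ∑ w : Fin (m + 1) → Fin 3, g (List.ofFn w) =
      ∑ i, ∑ w : Fin m → Fin 3, g (i :: List.ofFn w) := by
  rw [← (Fin.consEquiv (fun _ : Fin (m + 1) => Fin 3)).sum_comp, Fintype.sum_prod_type]
  simp [Fin.consEquiv, List.ofFn_succ]

theorem graphEnergy_succ (m : ℕ) (u : Vstar → ℝ) :
    graphEnergy (m + 1) u = ∑ i, 5 / 3 * graphEnergy m (u ∘ vertexMap [i]) := by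
  unfold graphEnergy
  rw [sum_words_succ m fun w => ∑ i, ∑ j, (u (vertex w i) - u (vertex w j)) ^ 2]
  simp only [Function.comp_apply, vertexMap_vertex, List.singleton_append]
  rw [Finset.mul_sum]
  refine Finset.sum_congr rfl fun i _ => ?_
  ring

/-- The level `m + 1` graph energy splits exactly by the first letter of the word; let `m → ∞`. -/
theorem energy_eq_sum (u : Vstar → ℝ) :
    energy u = ∑ i, ENNReal.ofReal (5 / 3) * energy (u ∘ vertexMap [i]) := by
  have h1 := (tendsto_add_atTop_iff_nat 1).2 (tendsto_graphEnergy u)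
  refine tendsto_nhds_unique h1 ?_
  have h2 : ∀ m, ENNReal.ofReal (graphEnergy (m + 1) u) =
      ∑ i, ENNReal.ofReal (5 / 3) * ENNReal.ofReal (graphEnergy m (u ∘ vertexMap [i])) := by
    intro m
    rw [graphEnergy_succ, ENNReal.ofReal_sum_of_nonneg fun i _ =>
      mul_nonneg (by norm_num) (graphEnergy_nonneg _ _)]
    exact Finset.sum_congr rfl fun i _ => ENNReal.ofReal_mul (by norm_num)
  simp only [h2]
  exact tendsto_finsetSum _ fun i _ =>
    ENNReal.Tendsto.const_mul (tendsto_graphEnergy _) (Or.inr ENNReal.ofReal_ne_top)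

theorem energy_eq_sum_words (m : ℕ) (u : Vstar → ℝ) :
    energy u = ENNReal.ofReal (5 / 3) ^ m *
      ∑ w : Fin m → Fin 3, energy (u ∘ vertexMap (List.ofFn w)) := by
  induction m generalizing u with
  | zero => simp [vertexMap_nil]
  | succ m ih =>
    rw [energy_eq_sum, sum_words_succ m fun w => energy (u ∘ vertexMap w), Finset.mul_sum]
    refine Finset.sum_congr rfl fun i _ => ?_
    rw [ih, pow_succ', mul_assoc]
    congr 2

/-- One summand of the self-similar decomposition is at most the whole sum. -/
theorem energy_comp_vertexMap_le (w : List (Fin 3)) (u : Vstar → ℝ) :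
    energy (u ∘ vertexMap w) ≤ ENNReal.ofReal (3 / 5) ^ w.length * energy u := by
  induction w generalizing u with
  | nil => simp [vertexMap_nil]
  | cons i w ih =>
    have h1 := ih (u ∘ vertexMap [i])
    rw [Function.comp_assoc, ← vertexMap_append, List.singleton_append] at h1
    refine h1.trans ?_
    have h2 : ENNReal.ofReal (5 / 3) * energy (u ∘ vertexMap [i]) ≤ energy u := by
      rw [energy_eq_sum u]
      exact Finset.single_le_sum
        (f := fun i => ENNReal.ofReal (5 / 3) * energy (u ∘ vertexMap [i]))
        (fun _ _ => zero_le) (Finset.mem_univ i)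
    rw [List.length_cons, pow_succ, mul_assoc]
    gcongr
    calc energy (u ∘ vertexMap [i])
        = ENNReal.ofReal (3 / 5) * (ENNReal.ofReal (5 / 3) * energy (u ∘ vertexMap [i])) := by
          rw [← mul_assoc, ← ENNReal.ofReal_mul (by norm_num)]
          norm_num
      _ ≤ _ := by gcongr

/-! ### The oscillation estimate -/

theorem abs_corner_sub_le {u : Vstar → ℝ} {e : ℝ} (he : 0 ≤ e)
    (hu : energy u ≤ ENNReal.ofReal (e ^ 2)) (i j : Fin 3) :
    |u (vertex [] i) - u (vertex [] j)| ≤ e := by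
  have h0 : graphEnergy 0 u ≤ e ^ 2 :=
    (ENNReal.ofReal_le_ofReal_iff (sq_nonneg e)).1
      ((le_iSup (fun m => ENNReal.ofReal (graphEnergy m u)) 0).trans hu)
  refine abs_le_of_sq_le_sq ?_ he
  refine le_trans ?_ h0
  simp only [graphEnergy, pow_zero, Fin.sum_univ_three, Finset.univ_unique, Finset.sum_singleton,
    List.ofFn_zero]
  fin_cases i <;> fin_cases j <;> simp <;>
    nlinarith [sq_nonneg (u (vertex [] 0) - u (vertex [] 1)),
      sq_nonneg (u (vertex [] 0) - u (vertex [] 2)), sq_nonneg (u (vertex [] 1) - u (vertex [] 2))]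

/-- Chaining through corners: corner `k` is fixed by `F k`, so it is also a corner of the first cell
`k`. Inside that cell the energy drops by `3/5 ≤ (4/5) ^ 2`, so `e` may be replaced by `4/5 * e`.
The constant `5` solves `1 + 5 * (4/5) = 5`, the sum of the geometric series. -/
theorem abs_vertex_sub_corner_le (w : List (Fin 3)) {u : Vstar → ℝ} {e : ℝ} (he : 0 ≤ e)
    (hu : energy u ≤ ENNReal.ofReal (e ^ 2)) (i j : Fin 3) :
    |u (vertex w i) - u (vertex [] j)| ≤ 5 * e := by
  induction w generalizing u e j with
  | nil => exact (abs_corner_sub_le he hu i j).trans (by linarith)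
  | cons k w ih =>
    have h1 := abs_corner_sub_le he hu k j
    have h2 : |u (vertex (k :: w) i) - u (vertex [] k)| ≤ 5 * (4 / 5 * e) := by
      have hk : energy (u ∘ vertexMap [k]) ≤ ENNReal.ofReal ((4 / 5 * e) ^ 2) := by
        refine (energy_comp_vertexMap_le [k] u).trans ?_
        rw [List.length_singleton, pow_one]
        refine (mul_le_mul_right hu _).trans ?_
        rw [← ENNReal.ofReal_mul (by norm_num)]
        exact ENNReal.ofReal_le_ofReal (by nlinarith [sq_nonneg e])
      have := ih (by positivity) hk k
      rwa [Function.comp_apply, Function.comp_apply, vertexMap_vertex, vertexMap_vertex,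
        List.append_nil, show vertex [k] k = vertex [] k from vertex_append_self [] k] at this
    have := abs_sub_le (u (vertex (k :: w) i)) (u (vertex [] k)) (u (vertex [] j))
    linarith

theorem abs_sub_le_of_energy_le {u : Vstar → ℝ} {e : ℝ} (he : 0 ≤ e)
    (hu : energy u ≤ ENNReal.ofReal (e ^ 2)) (x y : Vstar) : |u x - u y| ≤ 10 * e := by
  obtain ⟨w, i, rfl⟩ := exists_eq_vertex x
  obtain ⟨w', j, rfl⟩ := exists_eq_vertex y
  have h1 := abs_vertex_sub_corner_le w he hu i 0
  have h2 := abs_vertex_sub_corner_le w' he hu j 0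
  rw [abs_sub_comm] at h2
  have := abs_sub_le (u (vertex w i)) (u (vertex [] 0)) (u (vertex w' j))
  linarith

theorem abs_cell_sub_le (w : List (Fin 3)) {u : Vstar → ℝ} {e : ℝ} (he : 0 ≤ e)
    (hu : energy u ≤ ENNReal.ofReal (e ^ 2)) (x y : Vstar) :
    |u (vertexMap w x) - u (vertexMap w y)| ≤ 10 * e * (4 / 5) ^ w.length := by
  rw [mul_assoc]
  refine abs_sub_le_of_energy_le (u := u ∘ vertexMap w) (by positivity) ?_ x y
  refine (energy_comp_vertexMap_le w u).trans ?_
  refine (mul_le_mul_right hu _).trans ?_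
  rw [← ENNReal.ofReal_pow (by norm_num), ← ENNReal.ofReal_mul (by positivity)]
  refine ENNReal.ofReal_le_ofReal ?_
  rw [mul_pow e, mul_comm, ← pow_mul, mul_comm w.length 2, pow_mul]
  gcongr
  norm_num

/-! ### The continuous extension -/

theorem cat_length_add (w : List (Fin 3)) (ω : ℕ → Fin 3) (k : ℕ) :
    cat w ω (w.length + k) = ω k := by
  induction w with
  | nil => simp [cat]
  | cons i w ih =>
    rw [List.length_cons, add_right_comm]
    exact ih

theorem vertex_pref_add {ω : ℕ → Fin 3} {n : ℕ} {j : Fin 3} (h : ∀ k, ω (n + k) = j) (k : ℕ) :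
    vertex (pref (n + k) ω) j = vertex (pref n ω) j := by
  induction k with
  | zero => rfl
  | succ k ih => rw [← add_assoc, pref_succ', h k, vertex_append_self, ih]

/-- The vertices `F_{ω₁ … ωₘ}(corner j)` converge to `code ω`, and they no longer change once `m ≥
n`, because `F j` fixes corner `j`. -/
theorem code_eq_vertex {ω : ℕ → Fin 3} {n : ℕ} {j : Fin 3} (h : ∀ k, ω (n + k) = j) :
    code ω = vertex (pref n ω) j := by
  refine tendsto_nhds_unique
    ((continuous_code.tendsto ω).comp (tendsto_cat_pref ω fun _ => j)) ?_
  refine tendsto_const_nhds.congr' ?_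
  filter_upwards [eventually_ge_atTop n] with m hm
  obtain ⟨k, rfl⟩ := Nat.exists_eq_add_of_le hm
  rw [Function.comp_apply, code_cat, code_const, ← vertex_pref_add h k]
  rfl

theorem exists_eventually_const {ω ω' : ℕ → Fin 3} (h : code ω = code ω') (hne : ω ≠ ω') :
    (∃ n j, ∀ k, ω (n + k) = j) ∧ ∃ n j, ∀ k, ω' (n + k) = j := by
  classical
  have hex : ∃ n, ω n ≠ ω' n := Function.ne_iff.1 hne
  have hlt : ∀ k < Nat.find hex, ω k = ω' k := fun k hk => not_not.1 (Nat.find_min hex hk)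
  exact ⟨⟨_, eventually_const_of_code_eq _ ω ω' h (Nat.find_spec hex) hlt⟩,
    ⟨_, eventually_const_of_code_eq _ ω' ω h.symm (Nat.find_spec hex).symm
      fun k hk => (hlt k hk).symm⟩⟩

/-- The coding map onto the gasket. -/
noncomputable def codeMap : C(ℕ → Fin 3, gasket) where
  toFun ω := ⟨code ω, gasket_eq_range ▸ Set.mem_range_self ω⟩
  continuous_toFun := continuous_code.subtype_mk _

theorem codeMap_surjective : Function.Surjective codeMap := by
  rintro ⟨x, hx⟩
  obtain ⟨ω, rfl⟩ := gasket_eq_range ▸ hx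
  exact ⟨ω, rfl⟩

theorem isQuotientMap_codeMap : IsQuotientMap codeMap :=
  codeMap.continuous.isClosedMap.isQuotientMap codeMap.continuous codeMap_surjective

theorem energy_eq_ofReal_sq {u : Vstar → ℝ} (hu : energy u < ∞) :
    energy u = ENNReal.ofReal (√(energy u).toReal ^ 2) := by
  rw [Real.sq_sqrt ENNReal.toReal_nonneg, ENNReal.ofReal_toReal hu.ne]

/-- The extension is built on infinite words, as the uniform limit of `u` along the vertices of
shrinking cells, and then descends through the quotient map `codeMap`. Only points with several
addresses could obstruct this; their addresses are eventually constant, so they lie in `V_*`, where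
the limit is the value of `u` for either address. -/
theorem exists_continuous_extension {u : Vstar → ℝ} (hu : energy u < ∞) :
    ∃ v : C(gasket, ℝ), ∀ x, v (toGasket x) = u x := by
  set e := √(energy u).toReal
  -- Both vertices belong to the cell of the word `pref n ω`.
  have key : ∀ (ω : ℕ → Fin 3) (n : ℕ) (w : List (Fin 3)) (i j : Fin 3),
      dist (u (vertex (pref n ω) i)) (u (vertex (pref n ω ++ w) j)) ≤ 10 * e * (4 / 5) ^ n := by
    intro ω n w i j
    have := abs_cell_sub_le (pref n ω) (Real.sqrt_nonneg _) (energy_eq_ofReal_sq hu).le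
      (vertex [] i) (vertex w j)
    rwa [vertexMap_vertex, vertexMap_vertex, List.append_nil, length_pref] at this
  let a : ℕ → (ℕ → Fin 3) → ℝ := fun n ω => u (vertex (pref n ω) 0)
  have ha : ∀ ω n, dist (a n ω) (a (n + 1) ω) ≤ 10 * e * (4 / 5) ^ n := by
    intro ω n
    simp only [a, pref_succ']
    exact key ω n _ 0 0
  have hlim : ∀ ω, ∃ c, Tendsto (fun n => a n ω) atTop (𝓝 c) := fun ω =>
    cauchySeq_tendsto_of_complete (cauchySeq_of_le_geometric _ _ (by norm_num) (ha ω))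
  choose g hg using hlim
  have hpow : ∀ c : ℝ, Tendsto (fun n : ℕ => c * (4 / 5 : ℝ) ^ n) atTop (𝓝 0) := fun c => by
    simpa using (tendsto_pow_atTop_nhds_zero_of_lt_one (r := (4 / 5 : ℝ)) (by norm_num)
      (by norm_num)).const_mul c
  have hgc : Continuous g := by
    have hunif : TendstoUniformly a g atTop := by
      rw [Metric.tendstoUniformly_iff]
      intro ε hε
      filter_upwards [(hpow (10 * e / (1 - 4 / 5))).eventually_lt_const hε] with n hn ω
      rw [dist_comm]
      refine (dist_le_of_le_geometric_of_tendsto _ _ (by norm_num) (ha ω) (hg ω) n).trans_lt ?_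
      rwa [mul_div_right_comm]
    refine hunif.continuous (Eventually.of_forall fun n => ?_).frequently
    have h1 : Continuous fun f : Fin n → Fin 3 => u (vertex (List.ofFn f) 0) :=
      continuous_of_discreteTopology
    have h2 : Continuous fun ω : ℕ → Fin 3 => fun k : Fin n => ω k := by fun_prop
    exact h1.comp h2
  -- The limit is taken along corner `0`, whereas `y` is corner `j` of every late cell; `key` shows
  -- that the difference vanishes.
  have hgu : ∀ (ω : ℕ → Fin 3) (y : Vstar), code ω = y → (∃ n j, ∀ k, ω (n + k) = j) →
      g ω = u y := by
    rintro ω y hy ⟨n, j, h⟩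
    obtain rfl : y = vertex (pref n ω) j := Subtype.ext (hy.symm.trans (code_eq_vertex h))
    refine tendsto_nhds_unique (hg ω) ?_
    rw [tendsto_iff_dist_tendsto_zero]
    refine squeeze_zero' (Eventually.of_forall fun _ => dist_nonneg) ?_ (hpow (10 * e))
    filter_upwards [eventually_ge_atTop n] with m hm
    obtain ⟨k, rfl⟩ := Nat.exists_eq_add_of_le hm
    rw [← vertex_pref_add h k]
    simpa using key ω (n + k) [] 0 j
  have hfac : Function.FactorsThrough (⟨g, hgc⟩ : C(ℕ → Fin 3, ℝ)) codeMap := by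
    intro ω ω' h
    have hc : code ω = code ω' := congrArg Subtype.val h
    by_cases hne : ω = ω'
    · rw [hne]
    obtain ⟨h1, h2⟩ := exists_eventually_const hc hne
    have ⟨n, j, h3⟩ := h1
    have h4 := code_eq_vertex h3
    exact (hgu ω _ h4 h1).trans (hgu ω' _ (hc ▸ h4) h2).symm
  refine ⟨isQuotientMap_codeMap.lift _ hfac, fun x => ?_⟩
  obtain ⟨w, i, rfl⟩ := exists_eq_vertex x
  have hx : code (cat w fun _ => i) = vertex w i := by rw [code_cat, code_const]; rfl
  have h1 : toGasket (vertex w i) = codeMap (cat w fun _ => i) := Subtype.ext hx.symm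
  rw [h1]
  refine (DFunLike.congr_fun (isQuotientMap_codeMap.lift_comp _ hfac) _).trans ?_
  exact hgu _ _ hx ⟨w.length, i, fun k => cat_length_add w _ k⟩

/-- The oscillation bound passes from the dense set `V_*` to the gasket by continuity. In extended
form it is trivial for infinite energy, so it applies to `u ∘ F_w` with no finiteness check. -/
theorem enorm_sub_sq_le {u : Vstar → ℝ} {v : C(gasket, ℝ)} (hv : ∀ x, v (toGasket x) = u x)
    (x y : gasket) : ‖v x - v y‖ₑ ^ 2 ≤ 100 * energy u := by
  rcases eq_top_or_lt_top (energy u) with hu | hu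
  · simp [hu]
  have h : |v x - v y| ≤ 10 * √(energy u).toReal := by
    refine denseRange_toGasket.induction_on₂ (p := fun x y => |v x - v y| ≤ _) ?_ ?_ x y
    · exact isClosed_le (by fun_prop) continuous_const
    · intro x y
      rw [hv, hv]
      exact abs_sub_le_of_energy_le (Real.sqrt_nonneg _) (energy_eq_ofReal_sq hu).le x y
  rw [energy_eq_ofReal_sq hu, Real.enorm_eq_ofReal_abs, ← ENNReal.ofReal_pow (abs_nonneg _),
    show (100 : ℝ≥0∞) = ENNReal.ofReal 100 by norm_num, ← ENNReal.ofReal_mul (by norm_num)]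
  refine ENNReal.ofReal_le_ofReal ((pow_le_pow_left₀ (abs_nonneg _) h 2).trans_eq ?_)
  ring

theorem enorm_sq_le_add (s t : ℝ) : ‖s‖ₑ ^ 2 ≤ 2 * ‖t‖ₑ ^ 2 + 2 * ‖s - t‖ₑ ^ 2 := by
  simp only [Real.enorm_eq_ofReal_abs]
  rw [← ENNReal.ofReal_pow (abs_nonneg _), ← ENNReal.ofReal_pow (abs_nonneg _),
    ← ENNReal.ofReal_pow (abs_nonneg _), show (2 : ℝ≥0∞) = ENNReal.ofReal 2 by norm_num,
    ← ENNReal.ofReal_mul (by norm_num), ← ENNReal.ofReal_mul (by norm_num),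
    ← ENNReal.ofReal_add (by positivity) (by positivity)]
  refine ENNReal.ofReal_le_ofReal ?_
  simp only [sq_abs]
  nlinarith [sq_nonneg (s - 2 * t)]

/-! ### The cells -/

theorem cell_eq_range (w : List (Fin 3)) : cell w = Set.range (gasketMap w) := by
  ext x
  constructor
  · rintro ⟨y, hy, h⟩
    exact ⟨⟨y, hy⟩, Subtype.ext h⟩
  · rintro ⟨y, rfl⟩
    exact ⟨y, y.2, rfl⟩

instance : CompactSpace gasket :=
  isCompact_iff_compactSpace.1 (gasket_eq_range ▸ isCompact_range continuous_code)

theorem measurableSet_cell (w : List (Fin 3)) : MeasurableSet (cell w) :=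
  cell_eq_range w ▸ (isCompact_range (gasketMap w).continuous).measurableSet

theorem iUnion_cell (m : ℕ) : ⋃ w : Fin m → Fin 3, cell (List.ofFn w) = Set.univ := by
  have h : ∀ ω, ∃ y ∈ gasket, wordMap (pref m ω) y = code ω := by
    induction m with
    | zero => exact fun ω => ⟨_, gasket_eq_range ▸ Set.mem_range_self ω, rfl⟩
    | succ m ih =>
      intro ω
      obtain ⟨y, hy, h⟩ := ih fun k => ω (k + 1)
      refine ⟨y, hy, ?_⟩
      rw [pref_succ, code_eq, ← h]
      rfl
  refine Set.eq_univ_of_forall fun x => ?_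
  obtain ⟨ω, rfl⟩ := codeMap_surjective x
  exact Set.mem_iUnion.2 ⟨_, h ω⟩

theorem hausdorffMeasure_singleton (x : gasket) : hausdorffMeasure {x} = 0 := by
  have hle : ∀ m : ℕ, hausdorffMeasure {x} ≤ (3⁻¹ : ℝ≥0∞) ^ m := by
    intro m
    obtain ⟨w, hw⟩ := Set.mem_iUnion.1 ((iUnion_cell m).symm ▸ Set.mem_univ x)
    refine (measure_mono (Set.singleton_subset_iff.2 hw)).trans_eq ?_
    rw [hausdorffMeasure_cell, List.length_ofFn]
  exact le_antisymm (ge_of_tendsto' (ENNReal.tendsto_pow_atTop_nhds_zero_of_lt_one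
    (ENNReal.inv_lt_one.2 (by norm_num))) hle) bot_le

/-- A common point has two addresses, one beginning with `w` and one with `w'`. Such points are
countable, and `ν` has no atoms. -/
theorem aedisjoint_cell {w w' : List (Fin 3)} (hlen : w.length = w'.length) (hne : w ≠ w') :
    AEDisjoint hausdorffMeasure (cell w) (cell w') := by
  have : NullSingletonClass hausdorffMeasure := ⟨hausdorffMeasure_singleton⟩
  refine ((countable_multiple.image codeMap).mono ?_).measure_zero _
  rintro x ⟨hx, hx'⟩
  rw [cell_eq_range] at hx hx'
  obtain ⟨y, rfl⟩ := hx
  obtain ⟨y', h⟩ := hx'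
  obtain ⟨ω, rfl⟩ := codeMap_surjective y
  obtain ⟨ω', rfl⟩ := codeMap_surjective y'
  refine ⟨cat w ω, ⟨cat w' ω', fun heq => hne ?_, ?_⟩, Subtype.ext (code_cat w ω)⟩
  · have h1 := cat_mem_cyl w ω
    have h2 := cat_mem_cyl w' ω'
    rw [heq] at h2
    simp only [cyl, Set.mem_ofPred_eq] at h1 h2
    rw [← h1, ← h2, hlen]
  · rw [code_cat, code_cat]
    exact (congrArg Subtype.val h).symm

theorem sum_setLIntegral_cell (m : ℕ) (f : gasket → ℝ≥0∞) :
    ∑ w : Fin m → Fin 3, ∫⁻ x in cell (List.ofFn w), f x ∂hausdorffMeasure =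
      ∫⁻ x, f x ∂hausdorffMeasure := by
  rw [← setLIntegral_univ, ← iUnion_cell m, lintegral_iUnion₀
    (fun w => (measurableSet_cell _).nullMeasurableSet) _ f, tsum_fintype]
  intro w w' hne
  exact aedisjoint_cell (by simp) fun h => hne (List.ofFn_injective h)

theorem kusuokaMass_le_pow (w : List (Fin 3)) : kusuokaMass w ≤ (3 / 5) ^ w.length := by
  induction w using List.reverseRecOn with
  | nil =>
    simp [kusuokaMass, wordMatrix, P, Matrix.trace]
    norm_num
  | append_singleton w i ih =>
    rw [List.length_append, List.length_singleton, pow_succ']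
    exact (kusuokaMass_le w i).trans (by gcongr)

/-! ### The estimate at a fixed scale -/

theorem setLIntegral_cell_le {u : Vstar → ℝ} {v : C(gasket, ℝ)}
    (hv : ∀ x, v (toGasket x) = u x) (w : List (Fin 3)) :
    ∫⁻ x in cell w, ‖v x‖ₑ ^ 2 ∂kusuokaMeasure ≤ ENNReal.ofReal (3 / 5) ^ w.length *
      (2 * 3 ^ w.length * ∫⁻ x in cell w, ‖v x‖ₑ ^ 2 ∂hausdorffMeasure +
        200 * energy (u ∘ vertexMap w)) := by
  have hosc : ∀ x ∈ cell w, ∀ y ∈ cell w,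
      ‖v x‖ₑ ^ 2 ≤ 2 * ‖v y‖ₑ ^ 2 + 200 * energy (u ∘ vertexMap w) := by
    rw [cell_eq_range]
    rintro _ ⟨x, rfl⟩ _ ⟨y, rfl⟩
    have h1 := enorm_sub_sq_le (u := u ∘ vertexMap w) (v := v.comp (gasketMap w))
      (fun z => hv (vertexMap w z)) x y
    refine (enorm_sq_le_add _ (v (gasketMap w y))).trans ?_
    refine add_le_add le_rfl ((mul_le_mul_right h1 2).trans_eq ?_)
    rw [← mul_assoc]
    norm_num
  have hmeas : Measurable fun x => ‖v x‖ₑ ^ 2 := by fun_prop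
  have h3 : (3 : ℝ≥0∞) ^ w.length * (3⁻¹) ^ w.length = 1 := by
    rw [← mul_pow, ENNReal.mul_inv_cancel (by norm_num) (by norm_num), one_pow]
  have hsup : ∀ x ∈ cell w, ‖v x‖ₑ ^ 2 ≤
      2 * 3 ^ w.length * ∫⁻ x in cell w, ‖v x‖ₑ ^ 2 ∂hausdorffMeasure +
        200 * energy (u ∘ vertexMap w) := by
    intro x hx
    -- Average over `y` in the cell with `x` fixed; the factor `3 ^ w.length` is the inverse of the
    -- `ν`-mass of the cell.
    have h1 := setLIntegral_mono' (μ := hausdorffMeasure) (measurableSet_cell w) (hosc x hx)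
    rw [lintegral_add_right _ measurable_const, lintegral_const_mul _ hmeas, lintegral_const,
      lintegral_const, Measure.restrict_apply_univ, hausdorffMeasure_cell] at h1
    calc ‖v x‖ₑ ^ 2 = 3 ^ w.length * (‖v x‖ₑ ^ 2 * 3⁻¹ ^ w.length) := by
          rw [mul_left_comm, h3, mul_one]
      _ ≤ _ := mul_le_mul_right h1 _
      _ = _ := by
          rw [mul_add, mul_left_comm _ (200 * _), h3, mul_one, ← mul_assoc,
            mul_comm _ (2 : ℝ≥0∞)]
  refine (setLIntegral_mono' (measurableSet_cell w) hsup).trans ?_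
  rw [lintegral_const, Measure.restrict_apply_univ, kusuokaMeasure_cell, mul_comm,
    ← ENNReal.ofReal_pow (by norm_num)]
  gcongr
  exact kusuokaMass_le_pow w

theorem lintegral_kusuokaMeasure_le {u : Vstar → ℝ} {v : C(gasket, ℝ)}
    (hv : ∀ x, v (toGasket x) = u x) (m : ℕ) :
    ∫⁻ x, ‖v x‖ₑ ^ 2 ∂kusuokaMeasure ≤
      2 * ENNReal.ofReal (9 / 5) ^ m * ∫⁻ x, ‖v x‖ₑ ^ 2 ∂hausdorffMeasure +
        200 * ENNReal.ofReal (9 / 25) ^ m * energy u := by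
  have h1 : ENNReal.ofReal (3 / 5) ^ m * 3 ^ m = ENNReal.ofReal (9 / 5) ^ m := by
    rw [← mul_pow, show (3 : ℝ≥0∞) = ENNReal.ofReal 3 by norm_num,
      ← ENNReal.ofReal_mul (by norm_num)]
    norm_num
  have h2 : ENNReal.ofReal (9 / 25) ^ m * ENNReal.ofReal (5 / 3) ^ m =
      ENNReal.ofReal (3 / 5) ^ m := by
    rw [← mul_pow, ← ENNReal.ofReal_mul (by norm_num)]
    norm_num
  rw [← setLIntegral_univ, ← iUnion_cell m]
  -- For `μ` subadditivity suffices; almost disjointness of the cells is needed only for `ν`, to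
  -- reassemble its integral without overcounting.
  refine (lintegral_iUnion_le _ _).trans ?_
  rw [tsum_fintype]
  refine (Finset.sum_le_sum fun w _ => setLIntegral_cell_le hv _).trans_eq ?_
  simp only [List.length_ofFn]
  rw [← Finset.mul_sum, Finset.sum_add_distrib, ← Finset.mul_sum, ← Finset.mul_sum,
    sum_setLIntegral_cell m fun x => ‖v x‖ₑ ^ 2, energy_eq_sum_words m u, ← h1, ← h2]
  ring

theorem eLpNorm_two_sq {α : Type*} [MeasurableSpace α] (f : α → ℝ) (μ : Measure α) :
    eLpNorm f 2 μ ^ 2 = ∫⁻ x, ‖f x‖ₑ ^ 2 ∂μ := by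
  have := eLpNorm_nnreal_pow_eq_lintegral (f := f) (μ := μ) (p := 2) two_ne_zero
  simpa using this

end SierpinskiGasket

/-! ### The two interpolation inequalities -/

theorem mainTheorem6 :
    ∃ C : ℝ≥0, 0 < C ∧
      ∀ u : SierpinskiGasket.Vstar → ℝ, SierpinskiGasket.energy u < ∞ →
        ∃ v : C(SierpinskiGasket.gasket, ℝ),
          (∀ x : SierpinskiGasket.Vstar, v (SierpinskiGasket.toGasket x) = u x) ∧
          eLpNorm v 2 SierpinskiGasket.kusuokaMeasure ≤
            C * (SierpinskiGasket.energy u ^ ((SierpinskiGasket.spectralDim - 1) / 2) *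
                eLpNorm v 2 SierpinskiGasket.hausdorffMeasure ^ (2 - SierpinskiGasket.spectralDim) +
              eLpNorm v 2 SierpinskiGasket.hausdorffMeasure) ∧
          ((∀ x : SierpinskiGasket.Vstar, (x : SierpinskiGasket.Plane) ∈ SierpinskiGasket.V 0 → u x = 0) →
            eLpNorm v 2 SierpinskiGasket.kusuokaMeasure ≤
              C * (SierpinskiGasket.energy u ^ ((SierpinskiGasket.spectralDim - 1) / 2) *
                eLpNorm v 2 SierpinskiGasket.hausdorffMeasure ^
                  (2 - SierpinskiGasket.spectralDim))) := by
  refine ⟨200, by norm_num, fun u hu => ?_⟩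
  obtain ⟨v, hv⟩ := SierpinskiGasket.exists_continuous_extension hu
  have hμ : eLpNorm v 2 SierpinskiGasket.kusuokaMeasure ≠ ∞ :=
    (ContinuousMap.memLp _ ℝ v).eLpNorm_ne_top
  have hν : eLpNorm v 2 SierpinskiGasket.hausdorffMeasure ≠ ∞ :=
    (ContinuousMap.memLp _ ℝ v).eLpNorm_ne_top
  have hscale := SierpinskiGasket.lintegral_kusuokaMeasure_le hv
  -- The Poincaré inequality: compare `v x` with the value `0` at a corner and integrate over the
  -- probability measure `ν`.
  have hzero : (∀ x : SierpinskiGasket.Vstar,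
      (x : SierpinskiGasket.Plane) ∈ SierpinskiGasket.V 0 → u x = 0) →
      eLpNorm v 2 SierpinskiGasket.hausdorffMeasure ^ 2 ≤ 100 * SierpinskiGasket.energy u := by
    intro h0
    have h (x) : ‖v x‖ₑ ^ 2 ≤ 100 * SierpinskiGasket.energy u := by
      have := SierpinskiGasket.enorm_sub_sq_le hv x
        (SierpinskiGasket.toGasket (SierpinskiGasket.vertex [] 0))
      rwa [hv, h0 _ ⟨0, rfl⟩, sub_zero] at this
    rw [SierpinskiGasket.eLpNorm_two_sq]
    refine (lintegral_mono h).trans_eq ?_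
    simp
  simp only [← SierpinskiGasket.eLpNorm_two_sq] at hscale
  refine ⟨v, hv, ?_⟩
  obtain ⟨hd1, hd2⟩ := SierpinskiGasket.spectralDim_mem_Icc
  generalize eLpNorm v 2 SierpinskiGasket.kusuokaMeasure = a at *
  generalize eLpNorm v 2 SierpinskiGasket.hausdorffMeasure = b at *
  generalize SierpinskiGasket.energy u = e at *
  lift a to ℝ≥0 using hμ
  lift b to ℝ≥0 using hν
  lift e to ℝ≥0 using hu.ne
  -- With both norms and the energy finite, the estimate at each scale becomes one between real
  -- numbers.
  have hr (m : ℕ) : (a : ℝ) ^ 2 ≤ 2 * (9 / 5) ^ m * (b : ℝ) ^ 2 + 200 * (9 / 25) ^ m * e := by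
    have h : ∀ r : ℝ, ENNReal.ofReal r = (r.toNNReal : ℝ≥0∞) := fun _ => rfl
    have := hscale m
    rw [h, h] at this
    have h' : a ^ 2 ≤ 2 * (9 / 5 : ℝ).toNNReal ^ m * b ^ 2 +
        200 * (9 / 25 : ℝ).toNNReal ^ m * e := mod_cast this
    have h'' := NNReal.coe_le_coe.2 h'
    push_cast at h''
    rwa [Real.coe_toNNReal _ (by norm_num), Real.coe_toNNReal _ (by norm_num)] at h''
  obtain ⟨h1, h2⟩ := SierpinskiGasket.interpolation_of_scales a.2 b.2 e.2 hr
  rw [← ENNReal.coe_rpow_of_nonneg _ (by linarith), ← ENNReal.coe_rpow_of_nonneg _ (by linarith)]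
  refine ⟨?_, fun h0 => ?_⟩
  · have : a ≤ 200 * (e ^ ((SierpinskiGasket.spectralDim - 1) / 2) *
        b ^ (2 - SierpinskiGasket.spectralDim) + b) := by
      rw [← NNReal.coe_le_coe]
      push_cast
      exact h1
    exact mod_cast this
  · have hb : b ^ 2 ≤ 100 * e := mod_cast hzero h0
    have : a ≤ 200 * (e ^ ((SierpinskiGasket.spectralDim - 1) / 2) *
        b ^ (2 - SierpinskiGasket.spectralDim)) := by
      rw [← NNReal.coe_le_coe]
      push_cast
      exact h2 (mod_cast hb)
    exact mod_cast this
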